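/- Let $G=(V,E)$ be a finite graph, possibly with loops or multiple edges, with complex edge weights $\boldsymbol\lambda=(\lambda_e)_{e\in E}$ and, at each vertex $v\in V$, complex activities $u^{(v)}_0,\dots,u^{(v)}_{\deg(G,v)}$. For $H\subseteq E$ let $\deg(H,v)$ be the degree of $v$ in the spanning subgraph $(V,H)$ (a loop at $v$ counts twice), with $\deg(G,v)=\deg(E,v)$, and put $$Z(G,\boldsymbol\lambda,\mathbf u;\mathbf x)=\sum_{H\subseteq E}\Big(\prod_{e\in H}\lambda_e\Big)\Big(\prod_{v\in V}u^{(v)}_{\deg(H,v)}\Big)\prod_{v\in V}x_v^{\deg(H,v)},\qquad K_v(z)=\sum_{j=0}^{\deg(G,v)}\binom{\deg(G,v)}{j}u^{(v)}_j z^j .$$ Call a complex polynomial $F$ in one variable $A$-nonvanishing, for $A\subseteq\mathbb C$, if either $F\equiv 0$ or $F(z)\ne0$ for all $z\in A$. For $0<\theta\le\pi$ let $S[\theta]=\{z\in\mathbb C: z\neq0,\ |\arg z|<\theta\}$, where $-\pi<\arg z\le\pi$, and for $\kappa>0$ let $\kappa D=\{z\in\mathbb C:|z|<\kappa\}$ and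 $\kappa E=\{z\in\mathbb C:|z|>\kappa\}$. Then $Z(G,\boldsymbol\lambda,\mathbf u;y^{1/2}\mathbf 1)$ is a polynomial in $y$ (that is, there is a polynomial $W$ with $W(s^2)=Z(G,\boldsymbol\lambda,\mathbf u;s\mathbf 1)$ for all $s\in\mathbb C$), and the following hold. (a) Let $0\le\alpha<\pi/2$. If every $\lambda_e$ is real and nonnegative, and $K_v$ is $S[\pi-\alpha]$-nonvanishing for every $v\in V$, then $Z(G,\boldsymbol\lambda,\mathbf u;y^{1/2}\mathbf 1)$ is $S[\pi-2\alpha]$-nonvanishing. (b) Let $\kappa>0$ and $\lambda_{\max}>0$. If $|\lambda_e|\le\lambda_{\max}$ for every $e\in E$, and $K_v$ is $\kappa D$-nonvanishing for every $v\in V$, then $Z(G,\boldsymbol\lambda,\mathbf u;y^{1/2}\mathbf 1)$ is $(\kappa^2/\lambda_{\max})D$-nonvanishing. (c) Let $\kappa>0$ and $\lambda_{\min}>0$. If $|\lambda_e|\ge\lambda_{\min}$ for every $e\in E$, and $K_v$ is $\kappa E$-nonvanishing with $\deg K_v=\deg(G,v)$ for every $v\in V$, then $Z(G,\boldsymbol\lambda,\mathbf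 u;y^{1/2}\mathbf 1)$ is $(\kappa^2/\lambda_{\min})E$-nonvanishing. -/

import Mathlib

open scoped Polynomial ComplexOrder

noncomputable section

namespace WeightedSubgraphs

/-! Finite graphs, possibly with loops and multiple edges, are Mathlib's multigraphs `Graph α β`
with finitely many vertices and edges. A spanning subgraph is given by its set `H` of edges. -/

open Classical in
/-- The degree `deg(H, v)` of the vertex `v` in the spanning subgraph with edge set `H`: the number
of edges in `H` incident with `v`, with loops at `v` counted twice. -/
def deg {α β : Type*} (G : Graph α β) (H : Finset G.edgeSet) (v : G.vertexSet) : ℕ :=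
  (H.filter fun e : G.edgeSet => G.Inc e.1 v.1).card +
    (H.filter fun e : G.edgeSet => G.IsLoopAt e.1 v.1).card

/-- The polynomial `Z(G, lam, u; x) = ∑_H lam^H * u_{deg H} * x^{deg H}` in the variables `x_v`
(`v` a vertex), summed over all sets `H` of edges of `G`. The activity `u_j^{(v)}` is `u v j`;
only the values with `j ≤ deg(G, v)` matter. -/
def Z {α β : Type*} (G : Graph α β) [Fintype G.vertexSet] [Fintype G.edgeSet]
    (lam : G.edgeSet → ℂ) (u : G.vertexSet → ℕ → ℂ) : MvPolynomial G.vertexSet ℂ :=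
  ∑ H : Finset G.edgeSet,
    MvPolynomial.C ((∏ e ∈ H, lam e) * ∏ v, u v (deg G H v)) *
      ∏ v, MvPolynomial.X v ^ deg G H v

/-- The key polynomial `K_v(z) = ∑_{j=0}^d (d choose j) u_j^{(v)} z^j` with `d = deg(G, v)`. -/
def key {α β : Type*} (G : Graph α β) [Fintype G.edgeSet]
    (u : G.vertexSet → ℕ → ℂ) (v : G.vertexSet) : ℂ[X] :=
  ∑ j ∈ Finset.range (deg G Finset.univ v + 1),
    Polynomial.C (((deg G Finset.univ v).choose j : ℂ) * u v j) * Polynomial.X ^ j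

/-- `F` is `A`-nonvanishing: either `F` is identically zero or it has no zero in `A`. -/
def Nonvanishing (A : Set ℂ) (F : ℂ[X]) : Prop :=
  F = 0 ∨ ∀ z ∈ A, F.eval z ≠ 0

/-- The open sector `S[θ]` centred on the positive real axis. -/
def sector (θ : ℝ) : Set ℂ := {z | z ≠ 0 ∧ |z.arg| < θ}

/-- The open interior `κ D` of the disk of radius `κ` centred at the origin. -/
def diskInterior (κ : ℝ) : Set ℂ := {z | ‖z‖ < κ}

/-- The open exterior `κ E` of the disk of radius `κ` centred at the origin. -/
def diskExterior (κ : ℝ) : Set ℂ := {z | κ < ‖z‖}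

end WeightedSubgraphs

end

/-! Cut every edge into two half-edges, each with its own variable. The generating polynomial over
sets of half-edges is a product over vertices, whose factor at `v` is the polarization of `K_v`. If
`K_v` has no zeros in a disk or half-plane `A`, neither has its polarization with all variables in
`A` (Grace–Walsh–Szegő, from Laguerre's theorem on polar derivatives: `polarization_ne_zero`).

The edges are then glued back one at a time (Asano contraction). As a function of the two half-edges
of one edge, the polynomial is multiaffine; on the diagonal it is a quadratic `a + bz + cz²` without
zeros in `A`, and gluing replaces it by `a + cμ`, with `μ = λ_e y`. For a disk of radius `κ` and
`|μ| < κ²` this is nonzero because the product of the roots is `a/c`: this is (b). Complementing `H`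
and reversing the activities turns (c) into (b).

For (a), write `y = |y|w²` with `w` on the ray bisecting the angle from the positive axis to `y`;
the half-plane around `w` lies in `S[π-α]`. Since `0` is only on its boundary, the contraction is
made at a small `ε > 0`, and Hurwitz's theorem handles `ε → 0`. -/

namespace WeightedSubgraphs

/-! ### Laguerre sets and the Grace–Walsh–Szegő theorem -/

/-- A set of complex numbers for which, seen from each of its points `z`, the image of the
complement (with the point at infinity) under `r ↦ (z - r)⁻¹` is convex. -/
def IsLaguerre (A : Set ℂ) : Prop :=
  ∀ z ∈ A, Convex ℝ {ζ : ℂ | ζ = 0 ∨ z - ζ⁻¹ ∉ A}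

/-- Multiplying `|z - 1/ζ|² ≥ κ²` by `|ζ|²` gives a quadratic inequality in `ζ` whose leading
coefficient `κ² - |z|²` is positive, hence a closed disk. -/
lemma isLaguerre_diskInterior (κ : ℝ) : IsLaguerre (diskInterior κ) := by
  intro z hz
  simp only [diskInterior, Set.mem_ofPred_eq] at hz
  have hκ : 0 < κ := (norm_nonneg z).trans_lt hz
  have hq : 0 < κ ^ 2 - Complex.normSq z := by
    rw [Complex.normSq_eq_norm_sq]; nlinarith [norm_nonneg z]
  have key : {ζ : ℂ | ζ = 0 ∨ z - ζ⁻¹ ∉ diskInterior κ} =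
      {ζ : ℂ | (κ ^ 2 - Complex.normSq z) * Complex.normSq ζ + 2 * (z * ζ).re ≤ 1} := by
    ext ζ
    simp only [diskInterior, Set.mem_ofPred_eq, not_lt]
    by_cases h0 : ζ = 0
    · simp [h0]
    have hn : 0 < Complex.normSq ζ := Complex.normSq_pos.2 h0
    have h1 : ‖z - ζ⁻¹‖ ^ 2 * Complex.normSq ζ = Complex.normSq (z * ζ - 1) := by
      rw [← Complex.normSq_eq_norm_sq, ← Complex.normSq_mul, sub_mul, inv_mul_cancel₀ h0]
    have h2 : Complex.normSq (z * ζ - 1) =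
        Complex.normSq z * Complex.normSq ζ - 2 * (z * ζ).re + 1 := by
      rw [Complex.normSq_sub, Complex.normSq_mul]; simp; ring
    simp only [h0, false_or]
    rw [← sq_le_sq₀ hκ.le (norm_nonneg _), ← mul_le_mul_iff_left₀ hn, h1, h2]
    constructor <;> intro h <;> linarith
  rw [key]
  intro x hx y hy a b ha hb hab
  simp only [Set.mem_ofPred_eq, Complex.normSq_apply, Complex.mul_re, Complex.add_re,
    Complex.add_im, Complex.real_smul, Complex.ofReal_re, Complex.ofReal_im, zero_mul, sub_zero,
    add_zero, Complex.mul_im] at hx hy hq ⊢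
  obtain rfl : b = 1 - a := by linarith
  -- The convexity gap: `a|x|² + (1-a)|y|² - |ax + (1-a)y|² = a(1-a)|x-y|²`.
  have hk : 0 ≤ (κ ^ 2 - (z.re * z.re + z.im * z.im)) * (a * (1 - a)) *
      ((x.re - y.re) ^ 2 + (x.im - y.im) ^ 2) := by positivity
  nlinarith [mul_le_mul_of_nonneg_left hx ha, mul_le_mul_of_nonneg_left hy hb]

/-- The open half-plane of the points with positive inner product with `c`. -/
def halfPlane (c : ℂ) : Set ℂ := {z | 0 < (star c * z).re}

lemma isLaguerre_halfPlane (c : ℂ) : IsLaguerre (halfPlane c) := by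
  intro z hz
  simp only [halfPlane, Set.mem_ofPred_eq] at hz
  have key : {ζ : ℂ | ζ = 0 ∨ z - ζ⁻¹ ∉ halfPlane c} =
      {ζ : ℂ | (star c * z).re * Complex.normSq ζ ≤ (c * ζ).re} := by
    ext ζ
    simp only [halfPlane, Set.mem_ofPred_eq, not_lt]
    by_cases h0 : ζ = 0
    · simp [h0]
    have hn : 0 < Complex.normSq ζ := Complex.normSq_pos.2 h0
    have h1 : (star c * (z - ζ⁻¹)).re * Complex.normSq ζ =
        (star c * z).re * Complex.normSq ζ - (c * ζ).re := by
      have : (star c * ζ⁻¹).re * Complex.normSq ζ = (c * ζ).re := by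
        simp only [Complex.mul_re, Complex.inv_re, Complex.inv_im, Complex.star_def,
          Complex.conj_re, Complex.conj_im]
        field_simp
      rw [mul_sub, Complex.sub_re, sub_mul, this]
    simp only [h0, false_or]
    rw [← mul_le_mul_iff_left₀ hn, h1, zero_mul, sub_nonpos]
  rw [key]
  intro x hx y hy a b ha hb hab
  generalize (star c * z).re = q at *
  simp only [Set.mem_ofPred_eq, Complex.normSq_apply, Complex.mul_re, Complex.add_re,
    Complex.add_im, Complex.real_smul, Complex.ofReal_re, Complex.ofReal_im, zero_mul, sub_zero,
    add_zero, Complex.mul_im] at hx hy ⊢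
  obtain rfl : b = 1 - a := by linarith
  have hk : 0 ≤ q * (a * (1 - a)) * ((x.re - y.re) ^ 2 + (x.im - y.im) ^ 2) := by positivity
  nlinarith [mul_le_mul_of_nonneg_left hx ha, mul_le_mul_of_nonneg_left hy hb]

/-- Averages of `n` points of `C`, the missing ones taken to be `0`. In Laguerre's theorem these are
the `n - deg p` roots at infinity. -/
lemma inv_smul_multiset_sum_mem {C : Set ℂ} (hC : Convex ℝ C) (h0 : (0 : ℂ) ∈ C)
    (s : Multiset ℂ) (hs : ∀ x ∈ s, x ∈ C) (n : ℕ) (hn : 0 < n) (hcard : s.card ≤ n) :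
    ((n : ℝ)⁻¹) • s.sum ∈ C := by
  induction s using Multiset.induction_on generalizing n with
  | empty => simpa using h0
  | cons a s ih =>
    simp only [Multiset.card_cons] at hcard
    obtain ⟨k, rfl⟩ : ∃ k, n = k + 1 := ⟨n - 1, by omega⟩
    have ha : a ∈ C := hs a (by simp)
    rcases Nat.eq_zero_or_pos k with rfl | hk
    · have : s = 0 := Multiset.card_eq_zero.1 (by omega)
      simpa [this] using ha
    have h := ih (fun x hx => hs x (by simp [hx])) k hk (by omega)
    have h' := hC ha h (a := ((k + 1 : ℝ))⁻¹) (b := k * ((k + 1 : ℝ))⁻¹) (by positivity)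
      (by positivity) (by field_simp; ring)
    convert h' using 1
    have hk' : (k : ℝ) ≠ 0 := by positivity
    rw [smul_smul, Multiset.sum_cons, smul_add]
    congr 2
    · push_cast; rfl
    · push_cast; field_simp

/-- Laguerre's theorem: the polar derivative with pole in `A` preserves nonvanishing on `A`. -/
lemma polar_derivative_ne_zero {A : Set ℂ} (hA : IsLaguerre A) (p : ℂ[X]) (n : ℕ) (hn : 0 < n)
    (hp : p.natDegree ≤ n) (hpA : ∀ z ∈ A, p.eval z ≠ 0) {w z : ℂ} (hw : w ∈ A) (hz : z ∈ A) :
    n * p.eval z + (w - z) * p.derivative.eval z ≠ 0 := by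
  intro h
  have hz0 := hpA z hz
  have hn' : (n : ℂ) ≠ 0 := by exact_mod_cast hn.ne'
  have hwz : w ≠ z := by
    rintro rfl
    simp [hn', hz0] at h
  have hsum := (IsAlgClosed.splits p).eval_derivative_div_eval_of_ne_zero hz0
  have hmem := inv_smul_multiset_sum_mem (hA z hz) (by simp)
    (p.roots.map fun r => 1 / (z - r)) (by
      intro x hx
      obtain ⟨r, hr, rfl⟩ := Multiset.mem_map.1 hx
      right
      have : z - (1 / (z - r))⁻¹ = r := by simp
      rw [this]
      intro hrA
      exact hpA r hrA (Polynomial.isRoot_of_mem_roots hr)) n hn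
    (by simpa using (Polynomial.card_roots' p).trans hp)
  rw [← hsum] at hmem
  have hzw : z - w ≠ 0 := sub_ne_zero.2 hwz.symm
  -- Vanishing of the polar derivative says that the average of the `1/(z - r)` over the roots `r`
  -- is `1/(z - w)`; convexity then puts `w` outside `A`.
  have hval : ((n : ℝ)⁻¹) • (p.derivative.eval z / p.eval z) = (z - w)⁻¹ := by
    rw [Complex.real_smul]
    push_cast
    field_simp
    linear_combination -h
  rw [hval] at hmem
  rcases hmem with h' | h'
  · exact hzw (inv_eq_zero.1 h')
  · apply h'
    simpa using hw

/-- The polynomial `∑_j (d choose j) u_j X^j`. -/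
noncomputable def binomialPolynomial (d : ℕ) (u : ℕ → ℂ) : ℂ[X] :=
  ∑ j ∈ Finset.range (d + 1), Polynomial.C ((d.choose j : ℂ) * u j) * Polynomial.X ^ j

lemma coeff_binomialPolynomial (d : ℕ) (u : ℕ → ℂ) (j : ℕ) :
    (binomialPolynomial d u).coeff j = (d.choose j : ℂ) * u j := by
  simp only [binomialPolynomial, Polynomial.finsetSum_coeff, Polynomial.coeff_C_mul_X_pow,
    Finset.sum_ite_eq, Finset.mem_range]
  split_ifs with h
  · rfl
  · rw [Nat.choose_eq_zero_of_lt (by omega)]; simp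

lemma natDegree_binomialPolynomial_le (d : ℕ) (u : ℕ → ℂ) :
    (binomialPolynomial d u).natDegree ≤ d := by
  rw [Polynomial.natDegree_le_iff_coeff_eq_zero]
  intro j hj
  rw [coeff_binomialPolynomial, Nat.choose_eq_zero_of_lt hj]; simp

lemma polar_derivative_binomialPolynomial (d : ℕ) (u : ℕ → ℂ) (w : ℂ) :
    Polynomial.C ((d : ℂ) + 1) * binomialPolynomial d (fun j => u j + w * u (j + 1)) =
      Polynomial.C ((d : ℂ) + 1) * binomialPolynomial (d + 1) u +
        (Polynomial.C w - Polynomial.X) * (binomialPolynomial (d + 1) u).derivative := by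
  ext j
  rw [sub_mul, Polynomial.coeff_add, Polynomial.coeff_sub, Polynomial.coeff_C_mul,
    Polynomial.coeff_C_mul, Polynomial.coeff_C_mul]
  have hX : (Polynomial.X * (binomialPolynomial (d + 1) u).derivative).coeff j =
      j * ((d + 1).choose j * u j) := by
    cases j with
    | zero => simp
    | succ j =>
      rw [Polynomial.coeff_X_mul, Polynomial.coeff_derivative, coeff_binomialPolynomial]
      push_cast; ring
  rw [hX, Polynomial.coeff_derivative]
  simp only [coeff_binomialPolynomial]
  have h1 : ((d : ℂ) + 1) * d.choose j = (d + 1).choose (j + 1) * (j + 1) := by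
    exact_mod_cast Nat.add_one_mul_choose_eq d j
  have h2 : ((d + 1).choose j : ℂ) * (d + 1) = (d + 1) * d.choose j + j * (d + 1).choose j := by
    have h3 : ((d : ℂ) + 1) * (d + 1).choose j = (d + 1) * d.choose j + j * (d + 1).choose j := by
      cases j with
      | zero => simp
      | succ j =>
        have h4 : ((d : ℂ) + 1) * d.choose j = (d + 1).choose (j + 1) * (j + 1) := by
          exact_mod_cast Nat.add_one_mul_choose_eq d j
        rw [Nat.choose_succ_succ] at h4 ⊢
        push_cast at h4 ⊢
        linear_combination h4
    rw [mul_comm, h3]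
  linear_combination (w * u (j + 1)) * h1 - u j * h2

/-- The Grace–Walsh–Szegő theorem for the polarization of a polynomial. -/
lemma polarization_ne_zero {ι : Type*} {A : Set ℂ} (hA : IsLaguerre A)
    (s : Finset ι) (z : ι → ℂ) (hz : ∀ i ∈ s, z i ∈ A) (u : ℕ → ℂ)
    (hne : A.Nonempty) (hu : ∀ x ∈ A, (binomialPolynomial s.card u).eval x ≠ 0) :
    ∑ S ∈ s.powerset, u S.card * ∏ i ∈ S, z i ≠ 0 := by
  classical
  induction s using Finset.induction_on generalizing u with
  | empty =>
    obtain ⟨x, hx⟩ := hne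
    simpa [binomialPolynomial] using hu x hx
  | insert a s ha ih =>
    rw [Finset.card_insert_of_notMem ha] at hu
    -- Summing over whether `a ∈ S` replaces `u j` by `u j + z a * u (j + 1)`; on binomial
    -- polynomials this is the polar derivative with pole `z a`, up to a nonzero factor.
    have := ih (fun i hi => hz i (by simp [hi])) (fun j => u j + z a * u (j + 1)) (by
      intro x hx h0
      have h := polar_derivative_ne_zero hA _ (s.card + 1) (by omega)
        (natDegree_binomialPolynomial_le _ u) hu (hz a (by simp)) hx
      have h' := congrArg (Polynomial.eval x) (polar_derivative_binomialPolynomial s.card u (z a))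
      simp only [Polynomial.eval_mul, Polynomial.eval_C, Polynomial.eval_add, Polynomial.eval_sub,
        Polynomial.eval_X, h0, mul_zero] at h'
      apply h
      push_cast
      exact h'.symm)
    convert this using 1
    rw [Finset.sum_powerset_insert ha, ← Finset.sum_add_distrib]
    refine Finset.sum_congr rfl fun S hS => ?_
    have haS : a ∉ S := fun h => ha (Finset.mem_powerset.1 hS h)
    rw [Finset.card_insert_of_notMem haS, Finset.prod_insert haS]
    ring

/-! ### Hurwitz's theorem -/

/-- A polynomial without zeros in a ball grows at most like a power of the distance to the
centre. -/
lemma norm_eval_le_of_ball {p : ℂ[X]} {m : ℕ} (hp : p.natDegree ≤ m) {y₀ : ℂ} {r : ℝ} (hr : 0 < r)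
    (h : ∀ z ∈ Metric.ball y₀ r, p.eval z ≠ 0) (y : ℂ) :
    ‖p.eval y‖ ≤ ‖p.eval y₀‖ * (1 + ‖y - y₀‖ / r) ^ m := by
  have hs := IsAlgClosed.splits p
  rw [hs.eval_eq_prod_roots y, hs.eval_eq_prod_roots y₀, norm_mul, norm_mul, mul_assoc]
  refine mul_le_mul_of_nonneg_left ?_ (norm_nonneg _)
  have hone : 1 ≤ 1 + ‖y - y₀‖ / r := by simp only [le_add_iff_nonneg_right]; positivity
  have hroots : ∀ x ∈ p.roots, r ≤ ‖y₀ - x‖ := by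
    intro x hx
    by_contra! hlt
    exact h x (by rwa [Metric.mem_ball, dist_comm, dist_eq_norm]) (Polynomial.isRoot_of_mem_roots hx)
  refine le_trans ?_ (mul_le_mul_of_nonneg_left
    (pow_le_pow_right₀ hone ((Polynomial.card_roots' p).trans hp)) (norm_nonneg _))
  generalize p.roots = s at hroots
  induction s using Multiset.induction_on with
  | empty => simp
  | cons a s ih =>
    have ih' := ih fun x hx => hroots x (by simp [hx])
    have ha := hroots a (by simp)
    simp only [Multiset.map_cons, Multiset.prod_cons, norm_mul, Multiset.card_cons, pow_succ]
    have hstep : ‖y - a‖ ≤ ‖y₀ - a‖ * (1 + ‖y - y₀‖ / r) := by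
      have h1 : ‖y - a‖ ≤ ‖y - y₀‖ + ‖y₀ - a‖ := norm_sub_le_norm_sub_add_norm_sub _ _ _
      have h2 : ‖y - y₀‖ ≤ ‖y₀ - a‖ * (‖y - y₀‖ / r) := by
        rw [mul_div_assoc', le_div_iff₀ hr, mul_comm]
        exact mul_le_mul_of_nonneg_right ha (norm_nonneg _)
      linarith
    calc _ ≤ _ := mul_le_mul hstep ih' (norm_nonneg _) (by positivity)
      _ = _ := by ring

/-- Hurwitz's theorem for polynomials of bounded degree. -/
lemma nonvanishing_of_tendsto {p : ℕ → ℂ[X]} {q : ℂ[X]} {m : ℕ} (hp : ∀ n, (p n).natDegree ≤ m)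
    (hlim : ∀ z, Filter.Tendsto (fun n => (p n).eval z) Filter.atTop (nhds (q.eval z)))
    {U : Set ℂ} (hU : IsOpen U) (hpU : ∀ n, ∀ z ∈ U, (p n).eval z ≠ 0) : Nonvanishing U q := by
  refine or_iff_not_imp_right.2 fun hne => ?_
  push Not at hne
  obtain ⟨y₀, hy₀, h0⟩ := hne
  obtain ⟨r, hr, hball⟩ := Metric.isOpen_iff.1 hU y₀ hy₀
  refine Polynomial.funext fun y => ?_
  rw [Polynomial.eval_zero, ← norm_le_zero_iff]
  have h1 := (hlim y).norm
  have h2 := (hlim y₀).norm.mul_const ((1 + ‖y - y₀‖ / r) ^ m)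
  rw [h0, norm_zero, zero_mul] at h2
  -- The growth bound is proportional to the value at `y₀`, which tends to `0`; so the limit
  -- vanishes at every `y`.
  exact le_of_tendsto_of_tendsto' h1 h2 fun n =>
    norm_eval_le_of_ball (hp n) hr (fun z hz => hpU n z (hball hz)) y

lemma isOpen_sector {θ : ℝ} (hθ : θ ≤ Real.pi) : IsOpen (sector θ) := by
  rw [isOpen_iff_mem_nhds]
  rintro z ⟨hz, harg⟩
  have hslit : z ∈ Complex.slitPlane := by
    rw [Complex.mem_slitPlane_iff_arg]
    refine ⟨fun h => ?_, hz⟩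
    rw [h, abs_of_pos Real.pi_pos] at harg
    linarith
  have h1 : ∀ᶠ x in nhds z, |x.arg| < θ :=
    ((Complex.continuousAt_arg hslit).abs).eventually (gt_mem_nhds harg)
  filter_upwards [h1, isOpen_ne.mem_nhds hz] with x hx hx'
  exact ⟨hx', hx⟩

/-! ### Contraction of a single edge -/

lemma exists_quadratic_roots (a b : ℂ) {c : ℂ} (hc : c ≠ 0) :
    ∃ z₁ z₂ : ℂ, ∀ z, a + b * z + c * z ^ 2 = c * ((z - z₁) * (z - z₂)) := by
  obtain ⟨s, hs⟩ := IsAlgClosed.exists_pow_nat_eq (b ^ 2 - 4 * a * c) (n := 2) (by norm_num)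
  refine ⟨(-b + s) / (2 * c), (-b - s) / (2 * c), fun z => ?_⟩
  field_simp
  linear_combination hs

/-- Both roots have modulus at least `κ`, while a zero of `a + cμ` would make their product `-μ`. -/
lemma disk_contraction {κ : ℝ} (hκ : 0 < κ) {a b c μ : ℂ}
    (h : ∀ z ∈ diskInterior κ, a + b * z + c * z ^ 2 ≠ 0) (hμ : ‖μ‖ < κ ^ 2) :
    a + c * μ ≠ 0 := by
  have h0 := h 0 (by simpa [diskInterior] using hκ)
  simp only [mul_zero, ne_eq, OfNat.ofNat_ne_zero, not_false_eq_true, zero_pow, add_zero] at h0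
  by_cases hc : c = 0
  · simpa [hc] using h0
  obtain ⟨z₁, z₂, hz⟩ := exists_quadratic_roots a b hc
  have h1 : κ ≤ ‖z₁‖ := by
    by_contra! hlt
    exact h z₁ hlt (by rw [hz]; ring)
  have h2 : κ ≤ ‖z₂‖ := by
    by_contra! hlt
    exact h z₂ hlt (by rw [hz]; ring)
  intro hzero
  have hprod : μ = -(z₁ * z₂) := by
    apply mul_left_cancel₀ hc
    linear_combination hzero - hz 0
  rw [hprod, norm_neg, norm_mul] at hμ
  nlinarith [mul_le_mul h1 h2 hκ.le (norm_nonneg _)]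

/-- Both differences `ε - zᵢ` have positive inner product with `w`. A zero would give `(ε - z₁)(ε -
z₂) = -νw²`, but a product of two numbers with positive real part is never a nonpositive real. -/
lemma halfPlane_contraction {w ε a b c : ℂ} {ν : ℝ} (hν : 0 ≤ ν) (hε : ε ∈ halfPlane w)
    (h : ∀ z ∈ halfPlane w, a + b * z + c * z ^ 2 ≠ 0) :
    a + b * ε + c * (ε ^ 2 + ν * w ^ 2) ≠ 0 := by
  have h0 := h ε hε
  by_cases hc : c = 0
  · simpa [hc] using h0
  obtain ⟨z₁, z₂, hz⟩ := exists_quadratic_roots a b hc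
  have hroot : ∀ r, a + b * r + c * r ^ 2 = 0 → 0 < (star w * (ε - r)).re := by
    intro r hr
    have h1 : ¬ 0 < (star w * r).re := fun hlt => h r hlt hr
    have h2 : 0 < (star w * ε).re := hε
    rw [mul_sub, Complex.sub_re]
    linarith
  have h1 := hroot z₁ (by rw [hz]; ring)
  have h2 := hroot z₂ (by rw [hz]; ring)
  intro hzero
  have hprod : (ε - z₁) * (ε - z₂) = -(ν * w ^ 2) := by
    apply mul_left_cancel₀ hc
    linear_combination hzero - hz ε
  have hreal : (star w * (ε - z₁)) * (star w * (ε - z₂)) = ((-(ν * Complex.normSq w ^ 2) : ℝ) : ℂ) := by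
    push_cast
    rw [Complex.normSq_eq_conj_mul_self, Complex.star_def]
    linear_combination (starRingEnd ℂ w) ^ 2 * hprod
  generalize star w * (ε - z₁) = x at *
  generalize star w * (ε - z₂) = y at *
  have hre := congrArg Complex.re hreal
  have him := congrArg Complex.im hreal
  rw [Complex.mul_re, Complex.ofReal_re] at hre
  rw [Complex.mul_im, Complex.ofReal_im] at him
  have hnn : 0 ≤ ν * Complex.normSq w ^ 2 := by positivity
  have hpos : 0 < x.im * y.im := by nlinarith [mul_pos h1 h2]
  have e : x.re * (x.im * y.im) = -(x.im ^ 2 * y.re) := by linear_combination x.im * him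
  nlinarith [mul_pos h1 hpos, mul_nonneg (sq_nonneg x.im) h2.le]

/-- Nonvanishing of a multilinear form passes from `∏ P i` to `∏ Q i` one argument at a time. -/
lemma multilinear_ne_zero {ι M : Type*} [Finite ι] [AddCommGroup M] [Module ℂ M]
    (L : MultilinearMap ℂ (fun _ : ι => M) ℂ) (P Q : ι → Set M)
    (h : ∀ i, ∀ l : M →ₗ[ℂ] ℂ, (∀ m ∈ P i, l m ≠ 0) → ∀ m ∈ Q i, l m ≠ 0)
    (hP : ∀ m : ι → M, (∀ i, m i ∈ P i) → L m ≠ 0) (m : ι → M) (hm : ∀ i, m i ∈ Q i) :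
    L m ≠ 0 := by
  classical
  have := Fintype.ofFinite ι
  -- `T` is the set of arguments already moved from `P` to `Q`.
  suffices H : ∀ T : Finset ι, ∀ m : ι → M, (∀ i ∈ T, m i ∈ Q i) → (∀ i ∉ T, m i ∈ P i) →
      L m ≠ 0 from H Finset.univ m (fun i _ => hm i) (by simp)
  intro T
  induction T using Finset.induction_on with
  | empty => exact fun m _ hm => hP m fun i => hm i (by simp)
  | insert a T ha ih =>
    intro m hQ hPm
    have := h a (L.toLinearMap m a) (fun x hx => ?_) (m a) (hQ a (by simp))
    · simpa using this
    · refine ih _ (fun i hi => ?_) (fun i hi => ?_)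
      · have hia : i ≠ a := fun h => ha (h ▸ hi)
        simpa [Function.update_of_ne hia] using hQ i (by simp [hi])
      · by_cases hia : i = a
        · subst hia; simpa using hx
        · simpa [Function.update_of_ne hia] using hPm i (by simp [hia, hi])

/-! ### The half-edge polynomial -/

section HalfEdges

variable {E V : Type*} [DecidableEq E]

/-- The half-edges of the edge `e` in the set `S` of half-edges. -/
def slice (S : Finset (E × Bool)) (e : E) : Finset Bool := Finset.univ.filter fun b => (e, b) ∈ S

lemma slice_product (H : Finset E) (e : E) :
    slice (H ×ˢ (Finset.univ : Finset Bool)) e = if e ∈ H then Finset.univ else ∅ := by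
  ext b; split_ifs with h <;> simp [slice, h]

variable [Fintype E]

/-- The multilinear form `∑_S c(S) ∏_e m_e(S ∩ e)`, over all sets `S` of half-edges. -/
noncomputable def halfEdgeForm (c : Finset (E × Bool) → ℂ) :
    MultilinearMap ℂ (fun _ : E => Finset Bool → ℂ) ℂ :=
  ∑ S, c S • (MultilinearMap.mkPiAlgebra ℂ E ℂ).compLinearMap
    fun e => LinearMap.proj (slice S e)

lemma halfEdgeForm_apply (c : Finset (E × Bool) → ℂ) (m : E → Finset Bool → ℂ) :
    halfEdgeForm c m = ∑ S, c S * ∏ e, m e (slice S e) := by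
  simp [halfEdgeForm]

/-- The weights of the sets of half-edges of an edge after its contraction. -/
noncomputable def contracted (ε μ : ℂ) : Finset Bool → ℂ :=
  fun T => ε ^ T.card + if T = Finset.univ then μ else 0

/-- The products of points of `A`, indexed by the half-edges of one edge. -/
def productWeights (A : Set ℂ) : Set (Finset Bool → ℂ) :=
  {m | ∃ z : Bool → ℂ, (∀ b, z b ∈ A) ∧ m = fun T => ∏ b ∈ T, z b}

lemma linearMap_finset_bool (l : (Finset Bool → ℂ) →ₗ[ℂ] ℂ) : ∃ a b c : ℂ,
    ∀ ε μ : ℂ, l (contracted ε μ) = a + b * ε + c * (ε ^ 2 + μ) := by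
  let f : Finset Bool → ℂ := fun T => l fun j => if T = j then 1 else 0
  refine ⟨f ∅, f {false} + f {true}, f Finset.univ, fun ε μ => ?_⟩
  have huniv : (Finset.univ : Finset (Finset Bool)) = {∅, {false}, {true}, Finset.univ} := by
    decide
  rw [LinearMap.pi_apply_eq_sum_univ l, huniv, Finset.sum_insert (by decide),
    Finset.sum_insert (by decide), Finset.sum_insert (by decide), Finset.sum_singleton]
  have h0 : (∅ : Finset Bool) ≠ Finset.univ := by decide
  have h1 : ({false} : Finset Bool) ≠ Finset.univ := by decide
  have h2 : ({true} : Finset Bool) ≠ Finset.univ := by decide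
  simp only [contracted, h0, h1, h2, if_true, if_false, smul_eq_mul, Finset.card_empty,
    Finset.card_singleton, Finset.card_univ, Fintype.card_bool, pow_zero, pow_one, f]
  ring

lemma linearMap_ne_zero_of_productWeights {A : Set ℂ} {l : (Finset Bool → ℂ) →ₗ[ℂ] ℂ}
    (h : ∀ m ∈ productWeights A, l m ≠ 0) {z : ℂ} (hz : z ∈ A) : l (contracted z 0) ≠ 0 :=
  h _ ⟨fun _ => z, fun _ => hz, by ext T; simp [contracted, -Fintype.univ_bool]⟩

lemma prod_slice (S : Finset (E × Bool)) (z : E → Bool → ℂ) :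
    ∏ e, ∏ b ∈ slice S e, z e b = ∏ h ∈ S, z h.1 h.2 := by
  simp only [slice, Finset.prod_filter]
  rw [← Fintype.prod_prod_type' (f := fun e b => if (e, b) ∈ S then z e b else 1)]
  simp

variable [Fintype V] [DecidableEq V]

/-- The product of the activities `u_v(j)`, where `j` is the number of half-edges in `S` at `v`. -/
noncomputable def activity (t : E × Bool → V) (u : V → ℕ → ℂ) (S : Finset (E × Bool)) : ℂ :=
  ∏ v, u v (S.filter fun h => t h = v).card

/-- Each half-edge lies at exactly one vertex, so choosing `S` means choosing its part at each
vertex independently. -/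
lemma sum_activity_mul_prod (t : E × Bool → V) (u : V → ℕ → ℂ) (z : E × Bool → ℂ) :
    ∑ S, activity t u S * ∏ h ∈ S, z h =
      ∏ v, ∑ S ∈ (Finset.univ.filter fun h => t h = v).powerset, u v S.card * ∏ h ∈ S, z h := by
  rw [Finset.prod_univ_sum]
  refine Finset.sum_bij' (fun S _ v => S.filter fun h => t h = v)
    (fun p _ => Finset.univ.filter fun h => h ∈ p (t h)) ?_ ?_ ?_ ?_ ?_
  · intro S _
    rw [Fintype.mem_piFinset]
    exact fun v => Finset.mem_powerset.2 (Finset.filter_subset_filter _ (Finset.subset_univ _))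
  · simp
  · intro S _; ext h; simp
  · intro p hp
    rw [Fintype.mem_piFinset] at hp
    ext v h
    simp only [Finset.mem_filter, Finset.mem_univ, true_and]
    constructor
    · rintro ⟨h1, rfl⟩; exact h1
    · intro h1
      have := Finset.mem_powerset.1 (hp v) h1
      simp only [Finset.mem_filter, Finset.mem_univ, true_and] at this
      exact ⟨this ▸ h1, this⟩
  · intro S _
    rw [Finset.prod_mul_distrib, activity, Finset.prod_fiberwise]

/-- Contracting the edges preserves nonvanishing on a Laguerre set. -/
lemma halfEdgeForm_contracted_ne_zero {A : Set ℂ} (hA : IsLaguerre A) (hne : A.Nonempty)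
    (t : E × Bool → V) (u : V → ℕ → ℂ)
    (hu : ∀ v, ∀ x ∈ A,
      (binomialPolynomial (Finset.univ.filter fun h => t h = v).card (u v)).eval x ≠ 0)
    (ε : ℂ) (μ : E → ℂ)
    (hcontr : ∀ e, ∀ a b c : ℂ, (∀ z ∈ A, a + b * z + c * z ^ 2 ≠ 0) →
      a + b * ε + c * (ε ^ 2 + μ e) ≠ 0) :
    ∑ S, activity t u S * ∏ e, contracted ε (μ e) (slice S e) ≠ 0 := by
  rw [← halfEdgeForm_apply]
  refine multilinear_ne_zero _ (fun _ => productWeights A) (fun e => {contracted ε (μ e)})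
    ?_ ?_ _ (fun e => rfl)
  · rintro e l hl m rfl
    obtain ⟨a, b, c, habc⟩ := linearMap_finset_bool l
    rw [habc]
    refine hcontr e a b c fun z hz => ?_
    simpa [habc] using linearMap_ne_zero_of_productWeights hl hz
  · intro m hm
    choose z hz hmz using hm
    -- At product weights the form is the uncontracted half-edge polynomial, a product of
    -- polarizations.
    simp only [halfEdgeForm_apply, hmz, prod_slice]
    rw [sum_activity_mul_prod t u fun h => z h.1 h.2]
    exact Finset.prod_ne_zero_iff.2 fun v _ =>
      polarization_ne_zero hA _ _ (fun i _ => hz _ _) _ hne (hu v)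

lemma contracted_zero (μ : ℂ) (T : Finset Bool) :
    contracted 0 μ T = if T = ∅ then 1 else if T = Finset.univ then μ else 0 := by
  unfold contracted
  by_cases h : T = ∅
  · subst h
    simp [show (∅ : Finset Bool) ≠ Finset.univ by decide, -Fintype.univ_bool]
  · simp [h]

/-- At `ε = 0` an edge with exactly one half-edge in `S` has weight `0`, so only unions of whole
edges survive. -/
lemma sum_contracted_zero (c : Finset (E × Bool) → ℂ) (μ : E → ℂ) :
    ∑ S, c S * ∏ e, contracted 0 (μ e) (slice S e) =
      ∑ H : Finset E, c (H ×ˢ Finset.univ) * ∏ e ∈ H, μ e := by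
  symm
  refine Finset.sum_of_injOn (fun H => H ×ˢ Finset.univ) ?_ (by simp [Set.MapsTo]) ?_ ?_
  · intro H _ H' _ h
    ext e
    have := congrArg (fun S => (e, true) ∈ S) h
    simpa using this
  · intro S _ hS
    by_cases hall : ∀ e, slice S e = ∅ ∨ slice S e = Finset.univ
    · refine absurd ⟨Finset.univ.filter fun e => slice S e = Finset.univ, by simp, ?_⟩ hS
      ext ⟨e, b⟩
      have hmem : (e, b) ∈ S ↔ b ∈ slice S e := by simp [slice]
      rw [hmem]
      rcases hall e with h | h <;> simp [h, show (∅ : Finset Bool) ≠ Finset.univ by decide, -Fintype.univ_bool]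
    · push Not at hall
      obtain ⟨e, h1, h2⟩ := hall
      rw [Finset.prod_eq_zero (Finset.mem_univ e), mul_zero]
      rw [contracted_zero, if_neg (by simpa [Finset.nonempty_iff_ne_empty] using h1), if_neg h2]
  · intro H _
    congr 1
    rw [← Finset.prod_filter_mul_prod_filter_not Finset.univ (· ∈ H)]
    rw [Finset.prod_eq_one (s := Finset.univ.filter fun e => ¬ e ∈ H), mul_one]
    · rw [Finset.filter_mem_eq_inter, Finset.univ_inter]
      refine Finset.prod_congr rfl fun e he => ?_
      rw [slice_product, if_pos he, contracted_zero, if_pos rfl, if_neg (by decide)]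
    · intro e he
      rw [slice_product, if_neg (Finset.mem_filter.1 he).2, contracted_zero, if_pos rfl]

end HalfEdges

/-! ### Degrees and key polynomials in terms of half-edges -/

lemma exists_halfEdge_ends {α β : Type*} (G : Graph α β) :
    ∃ t : G.edgeSet × Bool → G.vertexSet,
      ∀ e, G.IsLink e.1 (t (e, false)).1 (t (e, true)).1 := by
  have h : ∀ e : G.edgeSet, ∃ x y : G.vertexSet, G.IsLink e.1 x.1 y.1 := fun e => by
    obtain ⟨x, y, hxy⟩ := G.exists_isLink_of_mem_edgeSet e.2
    exact ⟨⟨x, hxy.left_mem⟩, ⟨y, hxy.right_mem⟩, hxy⟩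
  choose x y hxy using h
  exact ⟨fun p => if p.2 then y p.1 else x p.1, fun e => by simpa using hxy e⟩

open Classical in
lemma deg_eq_card_halfEdges {α β : Type*} {G : Graph α β} {t : G.edgeSet × Bool → G.vertexSet}
    (ht : ∀ e, G.IsLink e.1 (t (e, false)).1 (t (e, true)).1) (H : Finset G.edgeSet)
    (v : G.vertexSet) :
    deg G H v = ((H ×ˢ (Finset.univ : Finset Bool)).filter fun h => t h = v).card := by
  rw [deg, Finset.card_filter, Finset.card_filter, Finset.card_filter, Finset.sum_product,
    ← Finset.sum_add_distrib]
  refine Finset.sum_congr rfl fun e _ => ?_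
  rw [Fintype.sum_bool]
  have h := ht e
  have hinc : G.Inc e.1 v.1 ↔ t (e, false) = v ∨ t (e, true) = v := by
    constructor
    · intro hi
      rcases hi.eq_or_eq_of_isLink h with h' | h'
      · exact Or.inl (Subtype.ext h'.symm)
      · exact Or.inr (Subtype.ext h'.symm)
    · rintro (rfl | rfl)
      · exact h.inc_left
      · exact h.inc_right
  have hloop : G.IsLoopAt e.1 v.1 ↔ t (e, false) = v ∧ t (e, true) = v := by
    rw [← Graph.isLink_self_iff, h.isLink_iff, Subtype.ext_iff, Subtype.ext_iff]
    tauto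
  by_cases h1 : t (e, false) = v <;> by_cases h2 : t (e, true) = v <;> simp [hinc, hloop, h1, h2]

variable {α β : Type*} {G : Graph α β}

lemma sum_deg [Fintype G.vertexSet] (H : Finset G.edgeSet) : ∑ v, deg G H v = 2 * H.card := by
  classical
  obtain ⟨t, ht⟩ := exists_halfEdge_ends G
  simp only [deg_eq_card_halfEdges ht]
  rw [← Finset.card_eq_sum_card_fiberwise (by simp [Set.MapsTo]), Finset.card_product,
    Finset.card_univ, Fintype.card_bool, mul_comm]

variable [Fintype G.edgeSet]

lemma deg_le (H : Finset G.edgeSet) (v : G.vertexSet) : deg G H v ≤ deg G Finset.univ v := by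
  classical
  exact Nat.add_le_add (Finset.card_le_card (Finset.filter_subset_filter _ (Finset.subset_univ _)))
    (Finset.card_le_card (Finset.filter_subset_filter _ (Finset.subset_univ _)))

open Classical in
lemma deg_add_deg_compl (H : Finset G.edgeSet) (v : G.vertexSet) :
    deg G H v + deg G Hᶜ v = deg G Finset.univ v := by
  have h : ∀ p : G.edgeSet → Prop,
      (H.filter p).card + (Hᶜ.filter p).card = (Finset.univ.filter p).card := by
    intro p
    rw [← Finset.card_union_of_disjoint, ← Finset.filter_union, Finset.union_compl]
    exact Finset.disjoint_filter_filter disjoint_compl_right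
  have h1 := h fun e => G.Inc e.1 v.1
  have h2 := h fun e => G.IsLoopAt e.1 v.1
  simp only [deg]
  omega

lemma key_eq_zero_iff {u : G.vertexSet → ℕ → ℂ} {v : G.vertexSet} :
    key G u v = 0 ↔ ∀ j ≤ deg G Finset.univ v, u v j = 0 := by
  change binomialPolynomial _ _ = 0 ↔ _
  rw [Polynomial.ext_iff]
  simp only [coeff_binomialPolynomial, Polynomial.coeff_zero, mul_eq_zero, Nat.cast_eq_zero,
    Nat.choose_eq_zero_iff]
  exact forall_congr' fun j => by rw [← not_lt]; tauto

open Classical in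
lemma key_eq_binomialPolynomial {t : G.edgeSet × Bool → G.vertexSet}
    (ht : ∀ e, G.IsLink e.1 (t (e, false)).1 (t (e, true)).1)
    (u : G.vertexSet → ℕ → ℂ) (v : G.vertexSet) :
    key G u v = binomialPolynomial (Finset.univ.filter fun h => t h = v).card (u v) := by
  change binomialPolynomial _ _ = _
  rw [deg_eq_card_halfEdges ht, Finset.univ_product_univ]

/-- The activities read backwards. -/
noncomputable def reverseActivity (G : Graph α β) [Fintype G.edgeSet]
    (u : G.vertexSet → ℕ → ℂ) : G.vertexSet → ℕ → ℂ :=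
  fun v j => u v (deg G Finset.univ v - j)

lemma eval_key_reverseActivity (u : G.vertexSet → ℕ → ℂ) (v : G.vertexSet) {z : ℂ} (hz : z ≠ 0) :
    (key G (reverseActivity G u) v).eval z =
      z ^ deg G Finset.univ v * (key G u v).eval z⁻¹ := by
  simp only [key, Polynomial.eval_finsetSum, Polynomial.eval_mul, Polynomial.eval_C,
    Polynomial.eval_pow, Polynomial.eval_X, reverseActivity]
  rw [← Finset.sum_range_reflect, Finset.mul_sum]
  refine Finset.sum_congr rfl fun j hj => ?_
  have hj' : j ≤ deg G Finset.univ v := by simpa [Nat.lt_succ_iff] using hj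
  rw [Nat.add_sub_cancel, Nat.choose_symm hj', Nat.sub_sub_self hj', pow_sub₀ z hz hj', inv_pow]
  ring

lemma eval_zero_key_reverseActivity (u : G.vertexSet → ℕ → ℂ) (v : G.vertexSet) :
    (key G (reverseActivity G u) v).eval 0 = (key G u v).coeff (deg G Finset.univ v) := by
  change (binomialPolynomial _ _).eval 0 = (binomialPolynomial _ _).coeff _
  rw [← Polynomial.coeff_zero_eq_eval_zero, coeff_binomialPolynomial, coeff_binomialPolynomial]
  simp [reverseActivity]

/-! ### Subgraph sums: interior and exterior of a disk -/

variable [Fintype G.vertexSet]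

/-- The sum `∑_H ∏_{e ∈ H} μ_e ∏_v u_v(deg(H, v))`. -/
noncomputable def subgraphSum (G : Graph α β) [Fintype G.vertexSet] [Fintype G.edgeSet]
    (μ : G.edgeSet → ℂ) (u : G.vertexSet → ℕ → ℂ) : ℂ :=
  ∑ H : Finset G.edgeSet, (∏ e ∈ H, μ e) * ∏ v, u v (deg G H v)

lemma subgraphSum_eq_zero {u : G.vertexSet → ℕ → ℂ} {v : G.vertexSet} (h : key G u v = 0)
    (μ : G.edgeSet → ℂ) : subgraphSum G μ u = 0 :=
  Finset.sum_eq_zero fun H _ => by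
    rw [Finset.prod_eq_zero (Finset.mem_univ v) (key_eq_zero_iff.1 h _ (deg_le H v)), mul_zero]

open Classical in
lemma subgraphSum_eq_sum_contracted {t : G.edgeSet × Bool → G.vertexSet}
    (ht : ∀ e, G.IsLink e.1 (t (e, false)).1 (t (e, true)).1)
    (μ : G.edgeSet → ℂ) (u : G.vertexSet → ℕ → ℂ) :
    subgraphSum G μ u = ∑ S, activity t u S * ∏ e, contracted 0 (μ e) (slice S e) := by
  rw [sum_contracted_zero, subgraphSum]
  refine Finset.sum_congr rfl fun H _ => ?_
  rw [mul_comm, activity]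
  simp only [deg_eq_card_halfEdges ht]

lemma subgraphSum_ne_zero_of_disk {κ : ℝ} (hκ : 0 < κ) {μ : G.edgeSet → ℂ}
    {u : G.vertexSet → ℕ → ℂ} (hμ : ∀ e, ‖μ e‖ < κ ^ 2)
    (hu : ∀ v, ∀ z ∈ diskInterior κ, (key G u v).eval z ≠ 0) : subgraphSum G μ u ≠ 0 := by
  classical
  obtain ⟨t, ht⟩ := exists_halfEdge_ends G
  rw [subgraphSum_eq_sum_contracted ht]
  refine halfEdgeForm_contracted_ne_zero (isLaguerre_diskInterior κ)
    ⟨0, by simpa [diskInterior] using hκ⟩ t u (fun v => ?_) 0 μ fun e a b c h => ?_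
  · rw [← key_eq_binomialPolynomial ht]; exact hu v
  · simpa using disk_contraction hκ h (hμ e)

/-- Substitute `H ↦ Hᶜ`, whose degree at `v` is `deg(G, v) - deg(H, v)`. -/
lemma subgraphSum_reverseActivity {μ : G.edgeSet → ℂ} (hμ : ∀ e, μ e ≠ 0)
    (u : G.vertexSet → ℕ → ℂ) :
    (∏ e, μ e) * subgraphSum G (fun e => (μ e)⁻¹) (reverseActivity G u) = subgraphSum G μ u := by
  classical
  rw [subgraphSum, subgraphSum, Finset.mul_sum]
  refine Fintype.sum_bijective compl compl_bijective _ _ fun H => ?_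
  rw [← mul_assoc, ← Finset.prod_mul_prod_compl H μ, mul_right_comm (∏ e ∈ H, μ e),
    ← Finset.prod_mul_distrib, Finset.prod_eq_one fun e _ => mul_inv_cancel₀ (hμ e), one_mul]
  congr 1
  refine Finset.prod_congr rfl fun v _ => ?_
  have h := deg_add_deg_compl H v
  simp only [reverseActivity]
  congr 1
  omega

lemma subgraphSum_ne_zero_of_exterior {κ : ℝ} (hκ : 0 < κ) {μ : G.edgeSet → ℂ}
    {u : G.vertexSet → ℕ → ℂ} (hμ : ∀ e, κ ^ 2 < ‖μ e‖)
    (hu : ∀ v, ∀ z ∈ diskExterior κ, (key G u v).eval z ≠ 0)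
    (hdeg : ∀ v, (key G u v).degree = (deg G Finset.univ v : WithBot ℕ)) :
    subgraphSum G μ u ≠ 0 := by
  have hμ0 : ∀ e, μ e ≠ 0 := fun e => norm_pos_iff.1 ((by positivity : 0 < κ ^ 2).trans (hμ e))
  rw [← subgraphSum_reverseActivity hμ0]
  refine mul_ne_zero (Finset.prod_ne_zero_iff.2 fun e _ => hμ0 e)
    (subgraphSum_ne_zero_of_disk (inv_pos.2 hκ) (fun e => ?_) fun v z hz => ?_)
  · rw [norm_inv, inv_pow]
    exact inv_strictAnti₀ (by positivity) (hμ e)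
  -- The value of the reversed key at `0` is the top coefficient of `K_v`; the degree hypothesis
  -- excludes a zero at infinity.
  · by_cases h0 : z = 0
    · subst h0
      rw [eval_zero_key_reverseActivity]
      exact Polynomial.coeff_ne_zero_of_eq_degree (hdeg v)
    · rw [eval_key_reverseActivity u v h0]
      refine mul_ne_zero (pow_ne_zero _ h0) (hu v _ ?_)
      have hz' : ‖z‖ < κ⁻¹ := hz
      change κ < ‖z⁻¹‖
      rw [norm_inv]
      exact (lt_inv_comm₀ (norm_pos_iff.2 h0) hκ).1 hz'

/-! ### Sectors, by perturbation -/

lemma mem_sector_of_mem_halfPlane {φ θ : ℝ} (hφ : |φ| + Real.pi / 2 ≤ θ) (hθ : θ ≤ Real.pi) {z : ℂ}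
    (hz : z ∈ halfPlane (Complex.exp (φ * Complex.I))) : z ∈ sector θ := by
  have hz0 : z ≠ 0 := by rintro rfl; simp [halfPlane] at hz
  refine ⟨hz0, ?_⟩
  have hre : 0 < ‖z‖ * Real.cos (z.arg - φ) := by
    have h : (star (Complex.exp (φ * Complex.I)) * z).re = ‖z‖ * Real.cos (z.arg - φ) := by
      have hs : star (Complex.exp (φ * Complex.I)) = Complex.exp (-(φ * Complex.I)) := by
        rw [Complex.star_def, ← Complex.exp_conj]; simp
      conv_lhs => rw [← Complex.norm_mul_exp_arg_mul_I z]
      rw [hs, mul_left_comm, ← Complex.exp_add, Complex.re_ofReal_mul,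
        show -(φ * Complex.I) + z.arg * Complex.I = ((z.arg - φ : ℝ) : ℂ) * Complex.I by
          push_cast; ring, Complex.exp_ofReal_mul_I_re]
    rw [← h]; exact hz
  have hcos : 0 < Real.cos (z.arg - φ) := pos_of_mul_pos_right hre (norm_nonneg _)
  by_contra! hge
  have h1 := Complex.neg_pi_lt_arg z
  have h2 := Complex.arg_le_pi z
  have h3 := abs_le.1 (le_refl |φ|)
  rcases le_abs.1 hge with h | h
  · exact absurd hcos (not_lt.2 (Real.cos_nonpos_of_pi_div_two_le_of_le (by linarith) (by linarith)))
  · rw [← Real.cos_neg] at hcos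
    exact absurd hcos (not_lt.2 (Real.cos_nonpos_of_pi_div_two_le_of_le (by linarith) (by linarith)))

open Classical in
/-- A perturbation by `ε` of the polynomial `∑_H λ^H u_{deg H} y^|H|` in `y`. -/
noncomputable def perturbedPolynomial (t : G.edgeSet × Bool → G.vertexSet) (lam : G.edgeSet → ℂ)
    (u : G.vertexSet → ℕ → ℂ) (ε : ℂ) : ℂ[X] :=
  ∑ S, Polynomial.C (activity t u S) * ∏ e, (Polynomial.C (ε ^ (slice S e).card) +
    if slice S e = Finset.univ then Polynomial.C (lam e) * Polynomial.X else 0)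

lemma natDegree_perturbedPolynomial_le (t : G.edgeSet × Bool → G.vertexSet) (lam : G.edgeSet → ℂ)
    (u : G.vertexSet → ℕ → ℂ) (ε : ℂ) :
    (perturbedPolynomial t lam u ε).natDegree ≤ Fintype.card G.edgeSet := by
  refine Polynomial.natDegree_sum_le_of_forall_le _ _ fun S _ =>
    (Polynomial.natDegree_C_mul_le _ _).trans ((Polynomial.natDegree_prod_le _ _).trans ?_)
  rw [← Finset.card_univ, Finset.card_eq_sum_ones]
  refine Finset.sum_le_sum fun e _ => Polynomial.natDegree_add_le_of_degree_le (by simp) ?_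
  split_ifs
  · exact (Polynomial.natDegree_C_mul_le _ _).trans Polynomial.natDegree_X_le
  · simp

open Classical in
lemma eval_perturbedPolynomial (t : G.edgeSet × Bool → G.vertexSet) (lam : G.edgeSet → ℂ)
    (u : G.vertexSet → ℕ → ℂ) (ε y : ℂ) :
    (perturbedPolynomial t lam u ε).eval y =
      ∑ S, activity t u S * ∏ e, contracted ε (lam e * y) (slice S e) := by
  simp only [perturbedPolynomial, contracted, Polynomial.eval_finsetSum, Polynomial.eval_mul,
    Polynomial.eval_prod, Polynomial.eval_add, Polynomial.eval_C, apply_ite (Polynomial.eval y),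
    Polynomial.eval_X, Polynomial.eval_zero]

lemma eval_perturbedPolynomial_ne_zero {t : G.edgeSet × Bool → G.vertexSet}
    (ht : ∀ e, G.IsLink e.1 (t (e, false)).1 (t (e, true)).1) {lam : G.edgeSet → ℂ}
    {u : G.vertexSet → ℕ → ℂ} {a : ℝ} (ha : 0 ≤ a) (hlam : ∀ e, 0 ≤ lam e)
    (hu : ∀ v, ∀ z ∈ sector (Real.pi - a), (key G u v).eval z ≠ 0) {ε : ℝ} (hε : 0 < ε)
    {y : ℂ} (hy : y ∈ sector (Real.pi - 2 * a)) :
    (perturbedPolynomial t lam u ε).eval y ≠ 0 := by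
  classical
  rw [eval_perturbedPolynomial]
  obtain ⟨-, harg⟩ := hy
  -- Halving the argument makes `λ_e y` a nonnegative multiple of `w²`, as the contraction requires,
  -- and keeps the half-plane around `w` inside the sector of the keys.
  set φ : ℝ := y.arg / 2 with hφ
  have hφa : |φ| < Real.pi / 2 - a := by rw [hφ, abs_div, abs_two]; linarith
  set w := Complex.exp (φ * Complex.I) with hw
  have hyw : y = (‖y‖ : ℝ) * w ^ 2 := by
    conv_lhs => rw [← Complex.norm_mul_exp_arg_mul_I y]
    rw [hw, ← Complex.exp_nat_mul, hφ]
    push_cast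
    congr 2
    ring
  have hεmem : (ε : ℂ) ∈ halfPlane w := by
    have hb := abs_lt.1 hφa
    have hcos : 0 < Real.cos φ :=
      Real.cos_pos_of_mem_Ioo ⟨by linarith [hb.1], by linarith [hb.2]⟩
    simp only [halfPlane, Set.mem_ofPred_eq, hw, Complex.star_def, Complex.re_mul_ofReal,
      Complex.conj_re, Complex.exp_ofReal_mul_I_re]
    positivity
  refine halfEdgeForm_contracted_ne_zero (isLaguerre_halfPlane w) ⟨ε, hεmem⟩ t u (fun v z hz => ?_)
    ε (fun e => lam e * y) fun e p q r h => ?_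
  · rw [← key_eq_binomialPolynomial ht]
    exact hu v z (mem_sector_of_mem_halfPlane (by linarith) (by linarith) hz)
  · obtain ⟨h1, h2⟩ := Complex.nonneg_iff.1 (hlam e)
    have hl : lam e = ((lam e).re : ℂ) := Complex.ext rfl (by simpa using h2.symm)
    have := halfPlane_contraction (mul_nonneg h1 (norm_nonneg y)) hεmem h
    push_cast at this
    rwa [mul_assoc, ← hyw, ← hl] at this

/-! ### The polynomial in `y` -/

/-- The polynomial `∑_H λ^H u_{deg H} y^|H|` in `y`. -/
noncomputable def edgePolynomial (G : Graph α β) [Fintype G.vertexSet] [Fintype G.edgeSet]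
    (lam : G.edgeSet → ℂ) (u : G.vertexSet → ℕ → ℂ) : ℂ[X] :=
  ∑ H : Finset G.edgeSet,
    Polynomial.C ((∏ e ∈ H, lam e) * ∏ v, u v (deg G H v)) * Polynomial.X ^ H.card

lemma eval_edgePolynomial (lam : G.edgeSet → ℂ) (u : G.vertexSet → ℕ → ℂ) (y : ℂ) :
    (edgePolynomial G lam u).eval y = subgraphSum G (fun e => lam e * y) u := by
  simp only [edgePolynomial, subgraphSum, Polynomial.eval_finsetSum, Polynomial.eval_mul,
    Polynomial.eval_C, Polynomial.eval_pow, Polynomial.eval_X, Finset.prod_mul_distrib,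
    Finset.prod_const]
  exact Finset.sum_congr rfl fun H _ => by ring

/-- By the handshake lemma `sum_deg`, every monomial of `Z` becomes `s^(2|H|)`. -/
lemma eval_edgePolynomial_sq (lam : G.edgeSet → ℂ) (u : G.vertexSet → ℕ → ℂ) (s : ℂ) :
    (edgePolynomial G lam u).eval (s ^ 2) = MvPolynomial.eval (fun _ => s) (Z G lam u) := by
  simp only [edgePolynomial, Z, Polynomial.eval_finsetSum, Polynomial.eval_mul,
    Polynomial.eval_prod, Polynomial.eval_C, Polynomial.eval_pow, Polynomial.eval_X, map_sum, map_mul, map_prod, map_pow,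
    MvPolynomial.eval_C, MvPolynomial.eval_X, Finset.prod_pow_eq_pow_sum, sum_deg, pow_mul]

lemma edgePolynomial_eq_zero {u : G.vertexSet → ℕ → ℂ} {v : G.vertexSet} (h : key G u v = 0)
    (lam : G.edgeSet → ℂ) : edgePolynomial G lam u = 0 :=
  Polynomial.funext fun y => by
    rw [eval_edgePolynomial, subgraphSum_eq_zero h, Polynomial.eval_zero]

/-- An identically zero key annihilates every term of the sum, so the keys may be assumed zero-free
on `A`. -/
lemma edgePolynomial_nonvanishing {A : Set ℂ} {B : Set ℂ} {lam : G.edgeSet → ℂ}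
    {u : G.vertexSet → ℕ → ℂ} (hu : ∀ v, Nonvanishing A (key G u v))
    (h : (∀ v, ∀ z ∈ A, (key G u v).eval z ≠ 0) → Nonvanishing B (edgePolynomial G lam u)) :
    Nonvanishing B (edgePolynomial G lam u) := by
  by_cases h0 : ∃ v, key G u v = 0
  · obtain ⟨v, hv⟩ := h0
    exact Or.inl (edgePolynomial_eq_zero hv lam)
  · push Not at h0
    exact h fun v => (hu v).resolve_left (h0 v)

lemma edgePolynomial_nonvanishing_sector {lam : G.edgeSet → ℂ} {u : G.vertexSet → ℕ → ℂ} {a : ℝ}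
    (ha : 0 ≤ a) (hlam : ∀ e, 0 ≤ lam e)
    (hu : ∀ v, ∀ z ∈ sector (Real.pi - a), (key G u v).eval z ≠ 0) :
    Nonvanishing (sector (Real.pi - 2 * a)) (edgePolynomial G lam u) := by
  classical
  obtain ⟨t, ht⟩ := exists_halfEdge_ends G
  refine nonvanishing_of_tendsto
    (p := fun n : ℕ => perturbedPolynomial t lam u ((1 / ((n : ℝ) + 1) : ℝ) : ℂ))
    (fun n => natDegree_perturbedPolynomial_le _ _ _ _) (fun z => ?_) (isOpen_sector (by linarith))
    fun n z hz => eval_perturbedPolynomial_ne_zero ht ha hlam hu (by positivity) hz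
  have hcont : Continuous fun ε : ℝ => (perturbedPolynomial t lam u (ε : ℂ)).eval z := by
    simp only [eval_perturbedPolynomial, contracted]
    fun_prop
  have hlim := (hcont.tendsto 0).comp (tendsto_one_div_add_atTop_nhds_zero_nat (𝕜 := ℝ))
  have h0 : (edgePolynomial G lam u).eval z = (perturbedPolynomial t lam u ((0 : ℝ) : ℂ)).eval z := by
    rw [eval_edgePolynomial, subgraphSum_eq_sum_contracted ht, eval_perturbedPolynomial,
      Complex.ofReal_zero]
  rw [h0]
  exact hlim

end WeightedSubgraphs

open WeightedSubgraphs in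
theorem corollary3p3 {α β : Type*} (G : Graph α β) [Fintype G.vertexSet] [Fintype G.edgeSet]
    (lam : G.edgeSet → ℂ) (u : G.vertexSet → ℕ → ℂ) :
    -- `W(y)` is the polynomial `Z(G, lam, u; y^{1/2} 1)` in `y`; the first condition determines it
    ∃ W : ℂ[X],
      (∀ y s : ℂ, s ^ 2 = y → W.eval y = MvPolynomial.eval (fun _ => s) (Z G lam u)) ∧
      -- part (a)
      (∀ a : ℝ, 0 ≤ a → a < Real.pi / 2 →
        (∀ e, 0 ≤ lam e) →
        (∀ v, Nonvanishing (sector (Real.pi - a)) (key G u v)) →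
        Nonvanishing (sector (Real.pi - 2 * a)) W) ∧
      -- part (b)
      (∀ κ lamMax : ℝ, 0 < κ → 0 < lamMax →
        (∀ e, ‖lam e‖ ≤ lamMax) →
        (∀ v, Nonvanishing (diskInterior κ) (key G u v)) →
        Nonvanishing (diskInterior (κ ^ 2 / lamMax)) W) ∧
      -- part (c)
      (∀ κ lamMin : ℝ, 0 < κ → 0 < lamMin →
        (∀ e, lamMin ≤ ‖lam e‖) →
        (∀ v, Nonvanishing (diskExterior κ) (key G u v)) →
        (∀ v, (key G u v).degree = (deg G Finset.univ v : WithBot ℕ)) →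
        Nonvanishing (diskExterior (κ ^ 2 / lamMin)) W) := by
  refine ⟨edgePolynomial G lam u, ?_, ?_, ?_, ?_⟩
  · rintro _ s rfl
    exact eval_edgePolynomial_sq lam u s
  · intro a ha _ hlam hu
    exact edgePolynomial_nonvanishing hu (edgePolynomial_nonvanishing_sector ha hlam)
  · intro κ lamMax hκ hmax hlam hu
    refine edgePolynomial_nonvanishing hu fun hu' => Or.inr fun y hy => ?_
    rw [eval_edgePolynomial]
    refine subgraphSum_ne_zero_of_disk hκ (fun e => ?_) hu'
    have hy' : ‖y‖ < κ ^ 2 / lamMax := hy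
    rw [lt_div_iff₀ hmax] at hy'
    rw [norm_mul, mul_comm]
    exact (mul_le_mul_of_nonneg_left (hlam e) (norm_nonneg y)).trans_lt hy'
  · intro κ lamMin hκ hmin hlam hu hdeg
    refine edgePolynomial_nonvanishing hu fun hu' => Or.inr fun y hy => ?_
    rw [eval_edgePolynomial]
    refine subgraphSum_ne_zero_of_exterior hκ (fun e => ?_) hu' hdeg
    have hy' : κ ^ 2 / lamMin < ‖y‖ := hy
    rw [div_lt_iff₀ hmin] at hy'
    rw [norm_mul, mul_comm]
    exact hy'.trans_le (mul_le_mul_of_nonneg_left (hlam e) (norm_nonneg y))
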